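/- Let $f_0=f_1=1$, $f_i=f_{i-1}+f_{i-2}$ $(i\ge 2)$. For an integer $n\ge 0$ let $F(n)$ be the number of Fibonacci partitions of $n$, i.e. of representations $n=f_{i_1}+\dots+f_{i_h}$ with $1\le i_1<\dots<i_h$ and $h\ge 0$ (so $F(0)=1$). Let $n=f_{\mu_1}+\dots+f_{\mu_q}$ with $\mu_1\ge 1$, $\mu_{a+1}-\mu_a\ge 2$ be the Zeckendorf representation of $n$. Put $\alpha_1=\lfloor(\mu_1-1)/2\rfloor+1$ and $\alpha_r=\lfloor(\mu_r-\mu_{r-1})/2\rfloor+1$ for $1<r\le q$. Cut the sequence $\mu_1,\dots,\mu_q$ into its maximal blocks of consecutive terms of equal parity, and let $A_1,\dots,A_s$ be the corresponding consecutive blocks of $(\alpha_1,\dots,\alpha_q)$. For a vector $A=(a_1,\dots,a_m)$ let $$\langle A\rangle=\cfrac{1}{a_1-\cfrac{1}{a_2-\cdots-\cfrac{1}{a_m}}}.$$ Let $\Gamma(\mathbb{Q}/\mathbb{Z})$ be the free monoid on the set of nonzero elements of $\mathbb{Q}/\mathbb{Z}$ (equivalently, on the set of rational numbers in $(0,1)$),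 let the zero element of $\mathbb{Q}/\mathbb{Z}$ stand for the unit of this monoid, and define $\pi:\{0,1,2,\dots\}\to\Gamma(\mathbb{Q}/\mathbb{Z})$ by $$\pi(n)=(\langle A_1\rangle \bmod \mathbb{Z})*\dots*(\langle A_s\rangle \bmod \mathbb{Z}),\qquad \pi(0)=1.$$ A number $n\ge 0$ is called essential if it is the least element of $\pi^{-1}(\gamma)$ for some $\gamma\in\Gamma(\mathbb{Q}/\mathbb{Z})$, and an essential $k$-number if moreover $F(n)=k$. Lemma. For every integer $k\ge 1$ the set of essential $k$-numbers is finite. Let $\Psi(k)$ be its cardinality. Then $\Psi(1)=1$ and for every $k>1$ $$\Psi(k)=\sum_{1<r\le k,\; r\mid k}\Psi(k/r)\,\varphi(r),$$ where $\varphi$ is Euler's totient function. -/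

import Mathlib

namespace FibPart

/-- The Fibonacci numbers `f 0 = f 1 = 1`, `f 2 = 2`, `f 3 = 3`, `f 4 = 5`, … -/
def f (i : ℕ) : ℕ := Nat.fib (i + 1)

/-- The Fibonacci partitions of `n`: finite sets of (distinct) Fibonacci numbers with sum `n`. -/
def fibPartitions (n : ℕ) : Set (Finset ℕ) :=
  {s | (∀ x ∈ s, ∃ i, 1 ≤ i ∧ x = f i) ∧ ∑ x ∈ s, x = n}

/-- `F n` is the number of Fibonacci partitions of `n`. -/
noncomputable def F (n : ℕ) : ℕ := (fibPartitions n).ncard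

/-- `Z n = [μ₁, …, μ_q]` is the increasing list of indices of the Zeckendorf representation
`n = f μ₁ + ⋯ + f μ_q`, with `1 ≤ μ₁` and `μ_{a+1} - μ_a ≥ 2`. Mathlib lists the indices in
decreasing order and with respect to `Nat.fib`, and `f i = Nat.fib (i + 1)`. -/
def Z (n : ℕ) : List ℕ := (n.zeckendorf.map (fun i => i - 1)).reverse

/-- The canonical form `(I₁; …; I_s)` of a 2-partition: the maximal blocks of consecutive entries
of equal parity. -/
def canonicalForm : List ℕ → List (List ℕ)
  | [] => []
  | [i] => [[i]]
  | i :: j :: l =>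
      if i % 2 = j % 2 then (canonicalForm (j :: l)).modifyHead (fun c => i :: c)
      else [i] :: canonicalForm (j :: l)

/-- The entries `⌊(i_r - i_{r-1}) / 2⌋ + 1`, where `i₀ = prev`. -/
def gapVector (prev : ℕ) : List ℕ → List ℕ
  | [] => []
  | i :: l => ((i - prev) / 2 + 1) :: gapVector i l

/-- The associated vector `α(I)`: `α₁ = ⌊(i₁ - 1) / 2⌋ + 1` and
`α_r = ⌊(i_r - i_{r-1}) / 2⌋ + 1` for `r > 1`. -/
def assocVector (I : List ℕ) : List ℕ := gapVector 1 I

/-- The associated multivector `V(I) = A₁ × ⋯ × A_s`: the associated vector, cut into consecutive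
pieces whose lengths are the dimensions of the components of the canonical form. -/
def V (I : List ℕ) : List (List ℕ) :=
  ((canonicalForm I).map List.length).splitLengths (assocVector I)

/-- The continued fraction `⟨α₁, …, α_q⟩ = 1 / (α₁ - 1 / (α₂ - ⋯ - 1 / α_q))`. -/
def contFrac : List ℕ → ℚ
  | [] => 0
  | a :: l => 1 / ((a : ℚ) - contFrac l)

/-- The monoid freely generated by the nonzero elements of `ℚ / ℤ`, each of which is identified
with its unique representative in the open interval `(0, 1)`. -/
abbrev Gam : Type := FreeMonoid (Set.Ioo (0 : ℚ) 1)

/-- The class of `g` modulo `ℤ` as an element of `Gam`; the zero class gives the unit. -/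
def letter (g : ℚ) : Gam :=
  if h : Int.fract g = 0 then 1
  else FreeMonoid.of ⟨Int.fract g, lt_of_le_of_ne (Int.fract_nonneg g) (Ne.symm h),
    Int.fract_lt_one g⟩

/-- The map `p (A₁ × ⋯ × A_s) = (⟨A₁⟩ mod ℤ) * ⋯ * (⟨A_s⟩ mod ℤ)`. -/
def p (A : List (List ℕ)) : Gam := (A.map (fun B => letter (contFrac B))).prod

/-- The projection from the natural numbers to `Gam`. -/
def proj (n : ℕ) : Gam := p (V (Z n))

/-- A number is essential if it is the lowest number of the fibre of `proj` over some element. -/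
def IsEssential (n : ℕ) : Prop := ∃ γ : Gam, IsLeast (proj ⁻¹' {γ}) n

/-- The set of essential `k`-numbers. -/
def essentials (k : ℕ) : Set ℕ := {n | IsEssential n ∧ F n = k}

/-- The number of essential `k`-numbers. -/
noncomputable def Psi (k : ℕ) : ℕ := (essentials k).ncard

end FibPart

namespace FibPart

/-! `F n` is the product of the denominators of the letters of `proj n` (`F_eq_norm`). Appending a
top Zeckendorf index with entry α replaces the current count T and the preceding count x by αT − x
if parity is kept, and by αT if it changes (`foldl_step`). Within a block this is the recursion for
continued-fraction denominators; a parity change restarts it, whence the product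
(`foldl_step_eq_prod`).

So `F` is constant on fibres of `proj`, and `proj` is onto (`proj_surjective`): essential k-numbers
correspond to words of norm k. Splitting off the first letter, one of φ(r) fractions of denominator
r > 1, leaves a word of norm k/r (`consWord_bijective`). -/

/-! ### Counting Fibonacci partitions -/

/-- The number of subsets of `{f 1, …, f m}` with sum `n`. -/
def boundedCount (m n : ℕ) : ℕ :=
  ((Finset.range m).powerset.filter (fun s => ∑ j ∈ s, f (j + 1) = n)).card

theorem f_add_two (i : ℕ) : f (i + 2) = f i + f (i + 1) := Nat.fib_add_two

theorem f_succ_succ (i : ℕ) : f (i + 1 + 1) = f i + f (i + 1) := Nat.fib_add_two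

theorem f_pos (i : ℕ) : 0 < f i := Nat.fib_pos.2 (Nat.succ_pos i)

theorem f_succ_strictMono : StrictMono (fun j => f (j + 1)) := Nat.fib_add_two_strictMono

theorem f_mono : Monotone f := fun _ _ h => Nat.fib_mono (Nat.succ_le_succ h)

theorem sum_range_f (m : ℕ) : ∑ j ∈ Finset.range m, f (j + 1) + 2 = f (m + 2) := by
  induction m with
  | zero => rfl
  | succ m ih =>
    rw [Finset.sum_range_succ, f_add_two (m + 1), ← ih]
    show _ + f (m + 1) + 2 = f (m + 1) + _
    omega

theorem boundedCount_eq_zero {m n : ℕ} (h : f (m + 2) < n + 2) : boundedCount m n = 0 := by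
  rw [boundedCount, Finset.card_eq_zero, Finset.filter_eq_empty_iff]
  intro s hs hn
  have := Finset.sum_le_sum_of_subset (f := fun j => f (j + 1)) (Finset.mem_powerset.1 hs)
  have := sum_range_f m
  omega

theorem boundedCount_succ (m n : ℕ) :
    boundedCount (m + 1) (f (m + 1) + n) = boundedCount m (f (m + 1) + n) + boundedCount m n := by
  unfold boundedCount
  rw [Finset.range_add_one, Finset.powerset_insert, Finset.filter_union,
    Finset.card_union_of_disjoint]
  · congr 1
    rw [Finset.filter_image, Finset.card_image_of_injOn]
    · congr 1
      refine Finset.filter_congr fun s hs => ?_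
      have : m ∉ s := fun h => by simpa using Finset.mem_powerset.1 hs h
      rw [Finset.sum_insert this]
      omega
    · intro s hs t ht h
      simp only [Finset.coe_filter, Finset.mem_powerset, Set.mem_ofPred_eq] at hs ht
      have h1 : m ∉ s := fun h => by simpa using hs.1 h
      have h2 : m ∉ t := fun h => by simpa using ht.1 h
      rw [← Finset.erase_insert h1, ← Finset.erase_insert h2]
      exact congrArg (fun u => Finset.erase u m) h
  · refine Finset.disjoint_filter_filter (Finset.disjoint_left.2 fun s hs ht => ?_)
    obtain ⟨t, -, rfl⟩ := Finset.mem_image.1 ht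
    simpa using Finset.mem_powerset.1 hs (Finset.mem_insert_self m t)

theorem F_eq_boundedCount {m n : ℕ} (h : n < f (m + 1)) : F n = boundedCount m n := by
  let e : ℕ ↪ ℕ := ⟨fun j => f (j + 1), f_succ_strictMono.injective⟩
  have key : fibPartitions n = Finset.map e ''
      ((Finset.range m).powerset.filter (fun s => ∑ j ∈ s, f (j + 1) = n) : Finset (Finset ℕ)) := by
    ext s
    simp only [fibPartitions, Set.mem_ofPred_eq, Set.mem_image, Finset.coe_filter,
      Finset.mem_powerset]
    constructor
    · rintro ⟨hs, hn⟩
      have hse : (s : Set ℕ) ⊆ Set.range e := by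
        intro x hx
        obtain ⟨i, hi, rfl⟩ := hs x hx
        exact ⟨i - 1, by simp [e, Nat.sub_add_cancel hi]⟩
      obtain ⟨t, rfl⟩ : ∃ t : Finset ℕ, t.map e = s := by
        obtain ⟨t, -, ht⟩ := Finset.subset_set_image_iff.1
          (show (s : Set ℕ) ⊆ e '' Set.univ by simpa using hse)
        exact ⟨t, by rw [Finset.map_eq_image, ht]⟩
      rw [Finset.sum_map] at hn
      refine ⟨t, ⟨fun j hj => ?_, hn⟩, rfl⟩
      rw [Finset.mem_range]
      by_contra hjm
      have h1 := Finset.single_le_sum (f := fun x => e x) (fun _ _ => Nat.zero_le _) hj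
      have h2 : f (m + 1) ≤ f (j + 1) := f_mono (by omega)
      have h3 : e j = f (j + 1) := rfl
      omega
    · rintro ⟨t, ⟨-, ht⟩, rfl⟩
      refine ⟨fun x hx => ?_, by rw [Finset.sum_map]; exact ht⟩
      obtain ⟨j, -, rfl⟩ := Finset.mem_map.1 hx
      exact ⟨j + 1, by omega, rfl⟩
  rw [F, key, Set.ncard_image_of_injective _ (Finset.map_injective e), Set.ncard_coe_finset,
    boundedCount]

/-- Without `f (m + 2)` the available terms sum to at most `f (m + 3) - 2`, so `f (m + 2)` is
forced; the two summands omit or use `f (m + 1)`. -/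
theorem boundedCount_split (m n : ℕ) :
    boundedCount (m + 2) (f (m + 3) + n) = boundedCount m (f (m + 1) + n) + boundedCount m n := by
  rw [f_add_two (m + 1), add_comm (f (m + 1)), add_assoc, boundedCount_succ (m + 1),
    boundedCount_succ m, boundedCount_eq_zero, zero_add]
  rw [f_add_two (m + 1)]
  omega

theorem boundedCount_split_iterate (m n d : ℕ) :
    boundedCount (m + 2 * d) (f (m + 2 * d + 1) + n) =
      boundedCount m (f (m + 1) + n) + ∑ j ∈ Finset.range d, boundedCount (m + 2 * j) n := by
  induction d with
  | zero => simp
  | succ d ih =>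
    rw [Finset.sum_range_succ, ← add_assoc, ← ih]
    exact boundedCount_split (m + 2 * d) n

theorem F_zero : F 0 = 1 := by
  rw [F_eq_boundedCount (m := 0) (f_pos 1)]
  rfl

theorem F_f (m : ℕ) : F (f (m + 1)) = m / 2 + 1 := by
  have h0 (k : ℕ) : boundedCount k 0 = 1 := by
    rw [← F_eq_boundedCount (f_pos _), F_zero]
  have h1 := boundedCount_succ m 0
  rw [add_zero, ← F_eq_boundedCount (show f (m + 1) < f (m + 1 + 1) from f_succ_strictMono (Nat.lt_succ_self m)), h0] at h1
  rw [h1]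
  obtain ⟨d, rfl | rfl⟩ := Nat.even_or_odd' m
  · have h3 : boundedCount 0 (f (0 + 1) + 0) = 0 := boundedCount_eq_zero (by decide)
    have h2 := boundedCount_split_iterate 0 0 d
    rw [h3] at h2
    simp only [h0, zero_add, add_zero] at h2
    rw [h2]
    simp
  · have h3 : boundedCount 1 (f (1 + 1) + 0) = 0 := boundedCount_eq_zero (by decide)
    have h2 := boundedCount_split_iterate 1 0 d
    rw [h3] at h2
    simp only [h0, zero_add, add_zero] at h2
    rw [add_comm 1] at h2
    rw [h2]
    simp
    omega

/-- The new term is kept whole or expanded in `d + 1` ways, none of which touches the indices up to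
`l + 1` that `n` needs. -/
theorem F_add_of_odd_gap {l n : ℕ} (d : ℕ) (hn : f (l + 1) ≤ n) (hn' : n < f (l + 2)) :
    F (f (l + 1 + 2 * (d + 1) + 1) + n) = (d + 2) * F n := by
  have hm : f (l + 2) ≤ f (l + 1 + 2 * (d + 1)) := f_mono (by omega)
  have hlt : f (l + 1 + 2 * (d + 1) + 1) + n < f (l + 1 + 2 * (d + 1) + 1 + 1) := by
    have := f_succ_succ (l + 1 + 2 * (d + 1))
    omega
  have hF (k : ℕ) (hk : l + 1 ≤ k) : boundedCount k n = F n :=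
    (F_eq_boundedCount (hn'.trans_le (f_mono (by omega)))).symm
  rw [F_eq_boundedCount hlt, boundedCount_succ, boundedCount_split_iterate,
    boundedCount_eq_zero, hF _ (by omega), Finset.sum_congr rfl (fun j _ => hF _ (by omega))]
  · simp
    ring
  · have := f_add_two (l + 1)
    show f (l + 1 + 2) < f (l + 1 + 1) + n + 2
    omega

/-- As for odd gaps, except that the longest expansion uses `f (l + 1)` itself: the rest must avoid
it, which loses `F n` partitions. -/
theorem F_add_of_even_gap {l n : ℕ} (d : ℕ) (hn : n < f l) :
    F (f (l + 1 + 2 * (d + 1)) + (f (l + 1) + n)) + F n = (d + 2) * F (f (l + 1) + n) := by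
  have hn' : f (l + 1) + n < f (l + 2) := by
    have := f_add_two l
    omega
  have hF (k : ℕ) (hk : l + 1 ≤ k) : boundedCount k (f (l + 1) + n) = F (f (l + 1) + n) :=
    (F_eq_boundedCount (hn'.trans_le (f_mono (by omega)))).symm
  have hm : f (l + 2) ≤ f (l + 2 * (d + 1)) := f_mono (by omega)
  have hlt : f (l + 2 * (d + 1) + 1) + (f (l + 1) + n) < f (l + 2 * (d + 1) + 1 + 1) := by
    have := f_succ_succ (l + 2 * (d + 1))
    omega
  have h1 := boundedCount_succ l n
  rw [hF _ le_rfl, ← F_eq_boundedCount (hn.trans_le (f_mono (by omega)))] at h1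
  rw [add_right_comm l, F_eq_boundedCount hlt, boundedCount_succ, boundedCount_split_iterate,
    boundedCount_eq_zero, hF _ (by omega), Finset.sum_range_succ',
    Finset.sum_congr rfl (fun j _ => hF _ (by omega))]
  · simp only [Finset.sum_const, Finset.card_range, smul_eq_mul, mul_zero, add_zero]
    linarith
  · have := f_add_two l
    have : f l ≤ f (l + 1) := f_mono (Nat.le_succ l)
    omega

/-! ### Zeckendorf index lists -/

/-- Indices of Zeckendorf representations, in increasing order. -/
def IsZeck (prev : ℕ) : List ℕ → Prop
  | [] => True
  | i :: l => prev ≤ i ∧ IsZeck (i + 2) l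

theorem isZeck_append_singleton {l : List ℕ} {prev i : ℕ} :
    IsZeck prev (l ++ [i]) ↔ IsZeck prev l ∧ prev ≤ i ∧ ∀ j ∈ l.getLast?, j + 2 ≤ i := by
  induction l generalizing prev with
  | nil => simp [IsZeck]
  | cons j l ih =>
    cases l with
    | nil => simp [IsZeck]; omega
    | cons k l =>
      have := @ih (j + 2)
      simp only [List.cons_append, IsZeck, List.getLast?_cons_cons] at this ⊢
      rw [this]
      constructor
      · rintro ⟨h1, ⟨h2, h3⟩, h4, h5⟩
        exact ⟨⟨h1, h2, h3⟩, by omega, h5⟩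
      · rintro ⟨⟨h1, h2, h3⟩, h4, h5⟩
        refine ⟨h1, ⟨h2, h3⟩, ?_, h5⟩
        have : ∀ (l : List ℕ) (p k : ℕ), IsZeck p (k :: l) → ∀ j ∈ (k :: l).getLast?, p ≤ j := by
          intro l
          induction l with
          | nil => rintro p k ⟨h, -⟩ j hj; simp at hj; omega
          | cons m l ih =>
            rintro p k ⟨h, h'⟩ j hj
            rw [List.getLast?_cons_cons] at hj
            have := ih (k + 2) m h' j hj
            omega
        obtain ⟨x, hx⟩ : ∃ x, (k :: l).getLast? = some x :=
          ⟨_, List.getLast?_eq_some_getLast (List.cons_ne_nil _ _)⟩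
        have h6 := this l (j + 2) k ⟨h2, h3⟩ x hx
        have h7 := h5 x hx
        omega

theorem isZeckendorfRep_iff {l : List ℕ} :
    l.reverse.IsZeckendorfRep ↔ IsZeck 2 l := by
  have key : ∀ (l : List ℕ) (p : ℕ), (p :: l).IsChain (fun a b => a + 2 ≤ b) ↔ IsZeck (p + 2) l := by
    intro l
    induction l with
    | nil => simp [IsZeck]
    | cons i l ih => intro p; rw [List.isChain_cons_cons, ih, IsZeck]
  rw [List.IsZeckendorfRep, ← List.reverse_cons, List.isChain_reverse]
  exact key l 0

theorem isZeck_map_succ {l : List ℕ} {p : ℕ} : IsZeck (p + 1) (l.map (· + 1)) ↔ IsZeck p l := by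
  induction l generalizing p with
  | nil => simp [IsZeck]
  | cons i l ih => simp only [List.map_cons, IsZeck, ← ih (p := i + 2)]; simp [add_right_comm]

theorem exists_eq_map_succ {l : List ℕ} {p : ℕ} (h : IsZeck (p + 1) l) :
    ∃ l' : List ℕ, l = l'.map (· + 1) := by
  induction l generalizing p with
  | nil => exact ⟨[], rfl⟩
  | cons i l ih =>
    obtain ⟨h1, h2⟩ := h
    obtain ⟨l', rfl⟩ := ih h2
    exact ⟨(i - 1) :: l', by simp; omega⟩

theorem Z_sum {I : List ℕ} (hI : IsZeck 1 I) : Z (I.map f).sum = I := by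
  have h := Nat.zeckendorf_sum_fib (isZeckendorfRep_iff.2 (isZeck_map_succ.2 hI))
  have h2 : ((I.map (· + 1)).reverse.map Nat.fib).sum = (I.map f).sum := by
    rw [List.map_reverse, List.sum_reverse, List.map_map]
    rfl
  rw [h2] at h
  rw [Z, h, List.map_reverse, List.reverse_reverse, List.map_map]
  simp [Function.comp_def]

theorem exists_isZeck (n : ℕ) : ∃ I, IsZeck 1 I ∧ (I.map f).sum = n := by
  have h := Nat.isZeckendorfRep_zeckendorf n
  have h2 := Nat.sum_zeckendorf_fib n
  rw [← List.reverse_reverse n.zeckendorf, isZeckendorfRep_iff] at h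
  obtain ⟨I, hI⟩ := exists_eq_map_succ h
  rw [hI] at h
  refine ⟨I, isZeck_map_succ.1 h, ?_⟩
  rw [← h2, ← List.reverse_reverse n.zeckendorf, hI, List.map_reverse, List.sum_reverse,
    List.map_map]
  rfl

/-! ### The two-term recursion for `F` -/

/-- A step of the recursion for `F` along the Zeckendorf indices: the state consists of the last
index, the number of partitions of the current sum and that of the preceding sum. -/
def step (s : ℕ × ℤ × ℤ) (i : ℕ) : ℕ × ℤ × ℤ :=
  (i, (((i - s.1) / 2 + 1 : ℕ) : ℤ) * s.2.1 - (if s.1 % 2 = i % 2 then s.2.2 else 0), s.2.1)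

/-- The initial index 1 produces α₁, and the initial 0 kills the correction there. The bound is
carried along because the even-gap formula needs it. -/
theorem foldl_step {I : List ℕ} (hI : IsZeck 1 I) {i : ℕ} (hi : IsZeck 1 (I ++ [i])) :
    (I.map f).sum < f (i - 1) ∧ (I ++ [i]).foldl step (1, 1, 0) =
      (i, (F (f i + (I.map f).sum) : ℤ), (F (I.map f).sum : ℤ)) := by
  induction I using List.reverseRecOn generalizing i with
  | nil =>
    obtain ⟨h, -⟩ := hi
    obtain ⟨m, rfl⟩ := Nat.exists_eq_add_of_le' h
    simp [step, F_zero, F_f, f_pos]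
  | append_singleton I j ih =>
    obtain ⟨h1, h2, h3⟩ := isZeck_append_singleton.1 hi
    have h4 : j + 2 ≤ i := h3 j (by simp)
    obtain ⟨h5, h6, h7⟩ := isZeck_append_singleton.1 hI
    obtain ⟨h8, h9⟩ := ih h5 hI
    obtain ⟨l, rfl⟩ := Nat.exists_eq_add_of_le' h6
    rw [Nat.add_sub_cancel] at h8
    rw [List.foldl_append, h9, List.map_append, List.sum_append, add_comm (I.map f).sum]
    set n := (I.map f).sum
    simp only [List.map_cons, List.map_nil, List.sum_cons, List.sum_nil, add_zero,
      List.foldl_cons, List.foldl_nil, step, Prod.mk.injEq, true_and, and_true]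
    have h10 := f_add_two l
    have h11 : f (l + 2) ≤ f (i - 1) := f_mono (by omega)
    refine ⟨by omega, ?_⟩
    obtain ⟨e, rfl⟩ := Nat.exists_eq_add_of_le h4
    obtain ⟨d, rfl | rfl⟩ := Nat.even_or_odd' e
    · rw [if_pos (by omega), show (l + 1 + 2 + 2 * d - (l + 1)) / 2 + 1 = d + 2 by omega,
        show l + 1 + 2 + 2 * d = l + 1 + 2 * (d + 1) by ring]
      have := F_add_of_even_gap d h8
      rw [sub_eq_iff_eq_add]
      exact_mod_cast this.symm
    · rw [if_neg (by omega), show (l + 1 + 2 + (2 * d + 1) - (l + 1)) / 2 + 1 = d + 2 by omega,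
        show l + 1 + 2 + (2 * d + 1) = l + 1 + 2 * (d + 1) + 1 by ring]
      have := F_add_of_odd_gap d (Nat.le_add_right (f (l + 1)) n) (by omega)
      rw [sub_zero]
      exact_mod_cast this.symm

theorem foldl_step_eq_F {I : List ℕ} (hI : IsZeck 1 I) :
    (I.foldl step (1, 1, 0)).2.1 = F (I.map f).sum := by
  rcases List.eq_nil_or_concat' I with rfl | ⟨I, i, rfl⟩
  · simp [F_zero]
  · rw [(foldl_step (isZeck_append_singleton.1 hI).1 hI).2, List.map_append, List.sum_append,
      add_comm]
    simp

/-! ### Blocks and continued fractions -/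

/-- The associated multivector, computed by direct recursion. -/
def blocks (prev : ℕ) : List ℕ → List (List ℕ)
  | [] => []
  | [i] => [[(i - prev) / 2 + 1]]
  | i :: j :: l =>
      if i % 2 = j % 2 then
        (blocks i (j :: l)).modifyHead (fun b => ((i - prev) / 2 + 1) :: b)
      else [(i - prev) / 2 + 1] :: blocks i (j :: l)

theorem exists_canonicalForm_cons (i : ℕ) (l : List ℕ) :
    ∃ c cs, canonicalForm (i :: l) = c :: cs := by
  induction l generalizing i with
  | nil => exact ⟨_, _, rfl⟩
  | cons j l ih =>
    rw [canonicalForm]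
    split_ifs
    · obtain ⟨c, cs, h⟩ := ih j
      exact ⟨i :: c, cs, by rw [h]; rfl⟩
    · exact ⟨_, _, rfl⟩

theorem splitLengths_gapVector (p : ℕ) (I : List ℕ) :
    ((canonicalForm I).map List.length).splitLengths (gapVector p I) = blocks p I := by
  induction I generalizing p with
  | nil => rfl
  | cons i l ih =>
    cases l with
    | nil => rfl
    | cons j l =>
      rw [canonicalForm, blocks, gapVector, ← ih i]
      split_ifs
      · obtain ⟨c, cs, h⟩ := exists_canonicalForm_cons j l
        simp [h]
      · simp

theorem V_eq_blocks (I : List ℕ) : V I = blocks 1 I := splitLengths_gapVector 1 I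

/-- Numerator and denominator of `contFrac`. -/
def numDen : List ℕ → ℤ × ℤ
  | [] => (0, 1)
  | a :: l => ((numDen l).2, a * (numDen l).2 - (numDen l).1)

/-- The value is linear in `T` and `x`, so arbitrary `T`, `x` make the induction close; at a parity
change `x` drops out and the finished block factors off. -/
theorem foldl_step_eq_prod (p i : ℕ) (l : List ℕ) : ∃ b bs, blocks p (i :: l) = b :: bs ∧
    ∀ T x : ℤ, ((i :: l).foldl step (p, T, x)).2.1 =
      (T * (numDen b).2 - (if p % 2 = i % 2 then x * (numDen b).1 else 0)) *
        (bs.map (fun c => (numDen c).2)).prod := by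
  induction l generalizing p i with
  | nil =>
    refine ⟨_, _, rfl, fun T x => ?_⟩
    simp [step, numDen, mul_comm T]
  | cons j l ih =>
    obtain ⟨b, bs, h1, h2⟩ := ih i j
    rw [blocks, h1]
    by_cases hij : i % 2 = j % 2
    · refine ⟨_, _, if_pos hij, fun T x => ?_⟩
      rw [List.foldl_cons, step, h2, if_pos hij, numDen]
      simp only
      split_ifs <;> ring
    · refine ⟨_, _, if_neg hij, fun T x => ?_⟩
      rw [List.foldl_cons, step, h2, if_neg hij]
      simp only [numDen, List.map_cons, List.prod_cons]
      split_ifs <;> ring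

theorem foldl_step_one_eq_prod (I : List ℕ) : (I.foldl step (1, 1, 0)).2.1 =
    ((blocks 1 I).map (fun c => (numDen c).2)).prod := by
  cases I with
  | nil => rfl
  | cons i l =>
    obtain ⟨b, bs, h1, h2⟩ := foldl_step_eq_prod 1 i l
    rw [h2, h1]
    simp

theorem two_le_of_mem_blocks {p : ℕ} {I : List ℕ} (hI : IsZeck (p + 2) I) :
    ∀ b ∈ blocks p I, ∀ a ∈ b, 2 ≤ a := by
  induction I generalizing p with
  | nil => simp [blocks]
  | cons i l ih =>
    obtain ⟨h1, h2⟩ := hI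
    have h3 : 2 ≤ (i - p) / 2 + 1 := by omega
    cases l with
    | nil => simpa [blocks] using h3
    | cons j l =>
      have := ih h2
      obtain ⟨b, bs, h4, -⟩ := foldl_step_eq_prod i j l
      rw [blocks]
      rw [h4] at this ⊢
      split_ifs
      · intro c hc
        rcases List.mem_cons.1 hc with rfl | hc
        · exact List.forall_mem_cons.2 ⟨h3, this b (by simp)⟩
        · exact this c (List.mem_cons_of_mem _ hc)
      · exact List.forall_mem_cons.2 ⟨by simpa using h3, this⟩

/-- Gaps between indices are at least 2, giving entries at least 2; only the first gap, from `p`,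
can give entry 1. -/
theorem exists_eq_cons_of_mem_blocks {p q : ℕ} {I : List ℕ} (hI : IsZeck q I) :
    ∀ b ∈ blocks p I, ∃ a l, b = a :: l ∧ 1 ≤ a ∧ ∀ c ∈ l, 2 ≤ c := by
  induction I generalizing p q with
  | nil => simp [blocks]
  | cons i l ih =>
    obtain ⟨-, h2⟩ := hI
    cases l with
    | nil => simp [blocks]
    | cons j l =>
      have h3 := ih (p := i) h2
      have h4 := two_le_of_mem_blocks h2
      obtain ⟨b, bs, h5, -⟩ := foldl_step_eq_prod i j l
      rw [blocks]
      rw [h5] at h3 h4 ⊢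
      split_ifs
      · intro c hc
        rcases List.mem_cons.1 hc with rfl | hc
        · exact ⟨_, _, rfl, by omega, h4 b (by simp)⟩
        · exact h3 c (List.mem_cons_of_mem _ hc)
      · intro c hc
        rcases List.mem_cons.1 hc with rfl | hc
        · exact ⟨_, _, rfl, by omega, by simp⟩
        · exact h3 c hc

theorem numDen_bounds {l : List ℕ} (hl : ∀ a ∈ l, 2 ≤ a) :
    0 ≤ (numDen l).1 ∧ (numDen l).1 < (numDen l).2 := by
  induction l with
  | nil => simp [numDen]
  | cons a l ih =>
    obtain ⟨h1, h2⟩ := ih fun c hc => hl c (List.mem_cons_of_mem _ hc)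
    have h3 : (2 : ℤ) ≤ a := by exact_mod_cast hl a (by simp)
    simp only [numDen]
    constructor <;> nlinarith

theorem isCoprime_numDen (l : List ℕ) : IsCoprime (numDen l).1 (numDen l).2 := by
  induction l with
  | nil => exact isCoprime_zero_left.2 isUnit_one
  | cons a l ih =>
    obtain ⟨u, v, h⟩ := ih
    exact ⟨v + u * a, -u, by simp only [numDen]; linear_combination h⟩

theorem contFrac_cons_eq {a : ℕ} {l : List ℕ} (hl : ∀ a ∈ l, 2 ≤ a) :
    contFrac (a :: l) = ((numDen (a :: l)).1 : ℚ) / (numDen (a :: l)).2 := by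
  induction l generalizing a with
  | nil => simp [contFrac, numDen]
  | cons b l ih =>
    have h1 := numDen_bounds hl
    have h2 : ((numDen (b :: l)).2 : ℚ) ≠ 0 := by
      have : (numDen (b :: l)).2 ≠ 0 := by omega
      exact_mod_cast this
    rw [contFrac, ih fun c hc => hl c (List.mem_cons_of_mem _ hc)]
    generalize b :: l = m at *
    rw [numDen]
    push_cast
    rw [sub_div' h2, one_div_div]

theorem den_contFrac {a : ℕ} {l : List ℕ} (ha : 1 ≤ a) (hl : ∀ a ∈ l, 2 ≤ a) :
    ((contFrac (a :: l)).den : ℤ) = (numDen (a :: l)).2 := by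
  obtain ⟨h1, h2⟩ := numDen_bounds hl
  have h3 : (1 : ℤ) ≤ a := by exact_mod_cast ha
  rw [contFrac_cons_eq hl]
  refine Rat.den_div_eq_of_coprime ?_ (Int.isCoprime_iff_nat_coprime.1 (isCoprime_numDen _))
  rw [numDen]
  nlinarith

/-- The product of the denominators of the letters of a word. -/
def norm : Gam →* ℕ := FreeMonoid.lift (fun x => x.1.den)

/-- The fractional part preserves the denominator; an integer gives the unit, consistently of norm
1. -/
theorem norm_letter (g : ℚ) : norm (letter g) = g.den := by
  rw [letter]
  split_ifs with h
  · rw [map_one, ← Rat.den_intFract, h, Rat.den_ofNat]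
  · exact Rat.den_intFract g

theorem F_eq_norm (n : ℕ) : F n = norm (proj n) := by
  obtain ⟨I, hI, rfl⟩ := exists_isZeck n
  rw [proj, Z_sum hI, V_eq_blocks, p, map_list_prod, List.map_map]
  zify
  rw [← foldl_step_eq_F hI, foldl_step_one_eq_prod, List.map_map]
  congr 1
  refine List.map_congr_left fun b hb => ?_
  obtain ⟨a, l, rfl, ha, hl⟩ := exists_eq_cons_of_mem_blocks hI b hb
  simp [norm_letter, den_contFrac ha hl]

/-! ### Surjectivity of the projection -/

/-- A gap `2 * (a - 1) + e` yields entry `a` for both `e = 0` (same block) and `e = 1` (new block),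
so entries and cuts can be prescribed independently. -/
theorem exists_blocks_eq_cons {Bs : List (List ℕ)}
    (hBs : ∀ p, ∃ I, IsZeck (p + 2) I ∧ blocks p I = Bs ∧ ∀ i ∈ I.head?, i % 2 = (p + 1) % 2)
    {a : ℕ} {l : List ℕ} (hl : ∀ c ∈ a :: l, 2 ≤ c) (p : ℕ) {e : ℕ} (he : e ≤ 1) :
    ∃ I, IsZeck (p + 2) I ∧ blocks p I = (a :: l) :: Bs ∧
      ∀ i ∈ I.head?, i % 2 = (p + e) % 2 := by
  have ha := hl a (by simp)
  induction l generalizing a p e with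
  | nil =>
    obtain ⟨I, h1, h2, h3⟩ := hBs (p + 2 * (a - 1) + e)
    refine ⟨(p + 2 * (a - 1) + e) :: I, ⟨by omega, h1⟩, ?_, by simp; omega⟩
    have h4 : (p + 2 * (a - 1) + e - p) / 2 + 1 = a := by omega
    cases I with
    | nil => rw [← h2]; simp only [blocks, h4]
    | cons j I =>
      have := h3 j (by simp)
      rw [blocks, if_neg (by omega), h2, h4]
  | cons c l ih =>
    have hl' := fun x hx => hl x (List.mem_cons_of_mem _ hx)
    obtain ⟨I, h1, h2, h3⟩ := ih hl' (p + 2 * (a - 1) + e) (Nat.zero_le 1) (hl' c (by simp))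
    refine ⟨(p + 2 * (a - 1) + e) :: I, ⟨by omega, h1⟩, ?_, by simp; omega⟩
    have h4 : (p + 2 * (a - 1) + e - p) / 2 + 1 = a := by omega
    cases I with
    | nil => simp [blocks] at h2
    | cons j I =>
      have := h3 j (by simp)
      rw [blocks, if_pos (by omega), h2, h4]
      rfl

theorem exists_blocks_eq {Bs : List (List ℕ)}
    (hBs : ∀ b ∈ Bs, b ≠ [] ∧ ∀ a ∈ b, 2 ≤ a) (p : ℕ) :
    ∃ I, IsZeck (p + 2) I ∧ blocks p I = Bs ∧ ∀ i ∈ I.head?, i % 2 = (p + 1) % 2 := by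
  induction Bs generalizing p with
  | nil => exact ⟨[], by simp [IsZeck, blocks]⟩
  | cons b Bs ih =>
    obtain ⟨h1, h2⟩ := hBs b (by simp)
    obtain ⟨a, l, rfl⟩ := List.exists_cons_of_ne_nil h1
    exact exists_blocks_eq_cons (fun p => ih (fun c hc => hBs c (List.mem_cons_of_mem _ hc)) p)
      h2 p le_rfl

/-- Euclidean descent with ceilings: `⌈g⁻¹⌉ - g⁻¹` has the numerator of `g` as denominator. -/
theorem exists_contFrac_eq {g : ℚ} (h0 : 0 ≤ g) (h1 : g < 1) :
    ∃ b : List ℕ, (∀ a ∈ b, 2 ≤ a) ∧ contFrac b = g := by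
  induction hd : g.den using Nat.strong_induction_on generalizing g with
  | _ d ih =>
    subst hd
    rcases h0.eq_or_lt with rfl | h0
    · exact ⟨[], by simp [contFrac]⟩
    have h2 : 1 < g⁻¹ := (one_lt_inv₀ h0).2 h1
    have h3 : 1 < ⌈g⁻¹⌉ := Int.lt_ceil.2 (by exact_mod_cast h2)
    have h4 := Int.le_ceil g⁻¹
    have h5 := Int.ceil_lt_add_one g⁻¹
    have h6 : (⌈g⁻¹⌉ - g⁻¹).den < g.den := by
      have h7 : (⌈g⁻¹⌉ - g⁻¹).den = g.num.natAbs := by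
        rw [Rat.intCast_sub_den, Rat.den_inv_of_ne_zero h0.ne']
      have := Rat.num_lt_denom_iff.2 h1
      have := Rat.num_pos.2 h0
      omega
    obtain ⟨b, hb, hb'⟩ := ih _ h6 (sub_nonneg.2 h4) (by linarith) rfl
    lift ⌈g⁻¹⌉ to ℕ using by omega with a ha
    refine ⟨a :: b, ?_, ?_⟩
    · rintro c hc
      rcases List.mem_cons.1 hc with rfl | hc
      · exact_mod_cast h3
      · exact hb c hc
    · rw [contFrac, hb']
      simp

theorem proj_surjective : Function.Surjective proj := by
  intro γ
  have key : ∀ γ : List (Set.Ioo (0 : ℚ) 1), ∃ Bs : List (List ℕ),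
      (∀ b ∈ Bs, b ≠ [] ∧ ∀ a ∈ b, 2 ≤ a) ∧ p Bs = FreeMonoid.ofList γ := by
    intro γ
    induction γ with
    | nil => exact ⟨[], by simp, rfl⟩
    | cons x γ ih =>
      obtain ⟨Bs, h1, h2⟩ := ih
      obtain ⟨b, h3, h4⟩ := exists_contFrac_eq x.2.1.le x.2.2
      have hx : Int.fract x.1 = x.1 := Int.fract_eq_self.2 ⟨x.2.1.le, x.2.2⟩
      refine ⟨b :: Bs, ?_, ?_⟩
      · rintro c hc
        rcases List.mem_cons.1 hc with rfl | hc
        · refine ⟨?_, h3⟩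
          rintro rfl
          exact x.2.1.ne h4
        · exact h1 c hc
      · rw [p] at h2
        rw [p, List.map_cons, List.prod_cons, h2, h4, letter, dif_neg (by rw [hx]; exact x.2.1.ne'),
          FreeMonoid.ofList_cons]
        congr 2
        exact Subtype.ext hx
  obtain ⟨Bs, h1, h2⟩ := key γ.toList
  obtain ⟨I, h3, h4, -⟩ := exists_blocks_eq h1 1
  have h5 : IsZeck 1 I := by
    cases I with
    | nil => trivial
    | cons i l => exact ⟨by have := h3.1; omega, h3.2⟩
  exact ⟨(I.map f).sum, by rw [proj, Z_sum h5, V_eq_blocks, h4, h2, FreeMonoid.ofList_toList]⟩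

/-! ### Counting words of given norm -/

/-- The words whose letters have denominators with product `k`. -/
def words (k : ℕ) : Set Gam := {γ | norm γ = k}

/-- The letters of denominator `r`. -/
def letters (r : ℕ) : Set (Set.Ioo (0 : ℚ) 1) := {x | x.1.den = r}

theorem injOn_proj_essentials (k : ℕ) : Set.InjOn proj (essentials k) := by
  rintro m ⟨⟨γ, h1⟩, -⟩ n ⟨⟨δ, h2⟩, -⟩ h
  have h3 : proj m = γ := h1.1
  have h4 : proj n = δ := h2.1
  rw [h3, h4] at h
  subst h
  exact h1.unique h2

theorem proj_image_essentials (k : ℕ) : proj '' essentials k = words k := by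
  ext γ
  constructor
  · rintro ⟨n, ⟨-, h⟩, rfl⟩
    rw [F_eq_norm] at h
    exact h
  · intro h
    have hne : (proj ⁻¹' {γ}).Nonempty := proj_surjective γ
    have h1 : proj (sInf (proj ⁻¹' {γ})) = γ := Nat.sInf_mem hne
    refine ⟨sInf (proj ⁻¹' {γ}), ⟨⟨γ, h1, fun m hm => Nat.sInf_le hm⟩, ?_⟩, h1⟩
    rw [F_eq_norm, h1]
    exact h

theorem one_lt_den (x : Set.Ioo (0 : ℚ) 1) : 1 < x.1.den := by
  have h1 := Rat.num_pos.2 x.2.1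
  have h2 := Rat.num_lt_denom_iff.2 x.2.2
  omega

theorem image_letters {r : ℕ} (hr : 1 < r) : Subtype.val '' letters r =
    (fun a : ℕ => (a : ℚ) / r) '' ((Finset.range r).filter (Nat.Coprime r) : Finset ℕ) := by
  have hr0 : (0 : ℚ) < r := by exact_mod_cast (by omega : 0 < r)
  ext g
  constructor
  · rintro ⟨x, hx, rfl⟩
    have hx : x.1.den = r := hx
    have h1 := Rat.num_pos.2 x.2.1
    have h2 := Rat.num_lt_denom_iff.2 x.2.2
    refine ⟨x.1.num.natAbs, ?_, ?_⟩
    · simp only [Finset.coe_filter, Finset.mem_range, Set.mem_ofPred_eq]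
      exact ⟨by omega, by rw [← hx]; exact x.1.reduced.symm⟩
    · have h3 : ((x.1.num.natAbs : ℕ) : ℚ) = x.1.num := by
        rw [← Int.cast_natCast, Int.natAbs_of_nonneg h1.le]
      simp only [h3, ← hx]
      exact Rat.num_div_den x.1
  · rintro ⟨a, ha, rfl⟩
    simp only [Finset.coe_filter, Finset.mem_range, Set.mem_ofPred_eq] at ha
    -- The range in the totient includes 0, which is not coprime to `r > 1`.
    have ha0 : 0 < a := by
      rcases Nat.eq_zero_or_pos a with rfl | h
      · have := (Nat.coprime_zero_right r).1 ha.2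
        omega
      · exact h
    refine ⟨⟨(a : ℚ) / r, div_pos (by exact_mod_cast ha0) hr0,
      (div_lt_one hr0).2 (by exact_mod_cast ha.1)⟩, ?_, rfl⟩
    have := Rat.den_div_eq_of_coprime (a := a) (b := r) (by omega) (by simpa using ha.2.symm)
    rw [Int.cast_natCast, Int.cast_natCast] at this
    exact Nat.cast_injective (R := ℤ) this

theorem finite_letters {r : ℕ} (hr : 1 < r) : (letters r).Finite := by
  rw [← Set.finite_image_iff Subtype.val_injective.injOn, image_letters hr]
  exact (Finset.finite_toSet _).image _

theorem ncard_letters {r : ℕ} (hr : 1 < r) : (letters r).ncard = r.totient := by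
  have hr0 : (r : ℚ) ≠ 0 := by exact_mod_cast (by omega : r ≠ 0)
  rw [← Set.ncard_image_of_injective _ Subtype.val_injective, image_letters hr,
    Set.ncard_image_of_injective, Set.ncard_coe_finset, Nat.totient]
  intro a b h
  exact_mod_cast (div_left_inj' hr0).1 h

theorem norm_of_mul (x : Set.Ioo (0 : ℚ) 1) (w : Gam) :
    norm (FreeMonoid.of x * w) = x.1.den * norm w := by
  rw [map_mul, norm, FreeMonoid.lift_eval_of]

theorem words_one : words 1 = {1} := by
  ext γ
  refine ⟨fun h => ?_, ?_⟩
  · have h : norm γ = 1 := h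
    induction γ using FreeMonoid.casesOn with
    | one => rfl
    | of_mul x w =>
      rw [norm_of_mul] at h
      have := Nat.eq_one_of_mul_eq_one_right h
      have := one_lt_den x
      omega
  · rintro rfl
    exact map_one norm

/-- Splitting off the first letter of a word. -/
def consWord (k : ℕ) (s : Σ r : (Finset.Ioc 1 k).filter (fun r => r ∣ k),
    letters r.1 × words (k / r.1)) : words k :=
  ⟨FreeMonoid.of s.2.1.1 * s.2.2.1, by
    obtain ⟨⟨r, hr⟩, ⟨x, hx⟩, ⟨w, hw⟩⟩ := s
    have hx : x.1.den = r := hx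
    have hw : norm w = k / r := hw
    show norm _ = k
    rw [norm_of_mul, hx, hw, Nat.mul_div_cancel' (Finset.mem_filter.1 hr).2]⟩

/-- Freeness recovers the first letter and the rest, and `r` is that letter's denominator; `k > 1`
excludes the empty word. -/
theorem consWord_bijective {k : ℕ} (hk : 1 < k) : Function.Bijective (consWord k) := by
  constructor
  · rintro ⟨⟨r, hr⟩, ⟨x, hx⟩, ⟨w, hw⟩⟩ ⟨⟨r', hr'⟩, ⟨x', hx'⟩, ⟨w', hw'⟩⟩ h
    have h : FreeMonoid.of x * w = FreeMonoid.of x' * w' := congrArg Subtype.val h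
    obtain ⟨rfl, rfl⟩ := List.cons_eq_cons.1 (congrArg FreeMonoid.toList h)
    obtain rfl : x.1.den = r := hx
    obtain rfl : x.1.den = r' := hx'
    rfl
  · rintro ⟨γ, h⟩
    have hγ : norm γ = k := h
    induction γ using FreeMonoid.casesOn with
    | one => rw [map_one] at hγ; omega
    | of_mul x w =>
      rw [norm_of_mul] at hγ
      have h1 := one_lt_den x
      refine ⟨⟨⟨x.1.den, ?_⟩, ⟨x, rfl⟩, ⟨w, ?_⟩⟩, rfl⟩
      · rw [Finset.mem_filter, Finset.mem_Ioc]
        exact ⟨⟨h1, Nat.le_of_dvd (by omega) ⟨_, hγ.symm⟩⟩, ⟨_, hγ.symm⟩⟩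
      · show norm w = k / x.1.den
        rw [← hγ, Nat.mul_div_cancel_left _ (by omega)]

theorem finite_words {k : ℕ} (hk : 1 ≤ k) : (words k).Finite := by
  induction k using Nat.strong_induction_on with
  | _ k ih =>
    rcases hk.eq_or_lt with rfl | hk
    · rw [words_one]
      exact Set.finite_singleton _
    · have (r : (Finset.Ioc 1 k).filter (fun r => r ∣ k)) :
          Finite (letters r.1 × words (k / r.1)) := by
        obtain ⟨⟨h1, h2⟩, -⟩ := by simpa only [Finset.mem_filter, Finset.mem_Ioc] using r.2
        have := (finite_letters h1).to_subtype
        have := (ih (k / r.1) (Nat.div_lt_self (by omega) h1)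
          (Nat.div_pos h2 (by omega))).to_subtype
        infer_instance
      exact Set.finite_coe_iff.1 (Finite.of_surjective _ (consWord_bijective hk).2)

theorem ncard_words {k : ℕ} (hk : 1 < k) : (words k).ncard =
    ∑ r ∈ (Finset.Ioc 1 k).filter (fun r => r ∣ k), (words (k / r)).ncard * r.totient := by
  have hr (r : (Finset.Ioc 1 k).filter (fun r => r ∣ k)) : 1 < r.1 ∧ r.1 ≤ k := by
    simpa only [Finset.mem_Ioc] using (Finset.mem_filter.1 r.2).1
  have (r : (Finset.Ioc 1 k).filter (fun r => r ∣ k)) :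
      Finite (letters r.1 × words (k / r.1)) := by
    have := (finite_letters (hr r).1).to_subtype
    have := (finite_words (Nat.div_pos (hr r).2 (by have := (hr r).1; omega))).to_subtype
    infer_instance
  rw [← Nat.card_coe_set_eq, ← Nat.card_eq_of_bijective _ (consWord_bijective hk), Nat.card_sigma,
    ← Finset.sum_coe_sort ((Finset.Ioc 1 k).filter (fun r => r ∣ k))]
  refine Finset.sum_congr rfl fun r _ => ?_
  rw [Nat.card_prod, Nat.card_coe_set_eq, Nat.card_coe_set_eq, ncard_letters (hr r).1, mul_comm]

theorem Psi_eq (k : ℕ) : Psi k = (words k).ncard := by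
  rw [Psi, ← proj_image_essentials, (injOn_proj_essentials k).ncard_image]

end FibPart

theorem lemma3p2 :
    (∀ k : ℕ, 1 ≤ k → (FibPart.essentials k).Finite) ∧
      FibPart.Psi 1 = 1 ∧
      ∀ k : ℕ, 1 < k →
        FibPart.Psi k =
          ∑ r ∈ (Finset.Ioc 1 k).filter (fun r => r ∣ k),
            FibPart.Psi (k / r) * Nat.totient r := by
  refine ⟨fun k hk => ?_, ?_, fun k hk => ?_⟩
  · rw [← Set.finite_image_iff (FibPart.injOn_proj_essentials k), FibPart.proj_image_essentials]
    exact FibPart.finite_words hk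
  · rw [FibPart.Psi_eq, FibPart.words_one, Set.ncard_singleton]
  · simp only [FibPart.Psi_eq]
    exact FibPart.ncard_words hk
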